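/- **Setting.** A *point cloud* is a finite family $P=(p_i)_{i\in[n]}$ of $n\ge 1$ points of $\mathbb R^3$ (not necessarily distinct), where point $i$ may carry a raw feature $x_i$ in a set $X$ (for unlabeled clouds $X$ is a one-point set). Put $d_{ij}=\|p_i-p_j\|$, $c=\frac1n\sum_i p_i$ and $\vec r_{ci}=p_i-c$. Two clouds $P,P'$ are *SE(3)-isomorphic* if they have the same number $n$ of points and there are a permutation $\sigma$ of $[n]$, a rotation $R\in SO(3)$ and $t\in\mathbb R^3$ with $p'_{\sigma(i)}=Rp_i+t$ and $x'_{\sigma(i)}=x_i$ for all $i$. A map $f$ on the set of all point clouds (of all sizes) is *SE(3)-complete* if it takes equal values on SE(3)-isomorphic clouds and different values on any two clouds that are not SE(3)-isomorphic. **GeoNGNN-C.** The parameters are numbers of layers $N_{\rm in},N_{\rm out}\in\mathbb N$, radii $r_{\rm sub},r_{\rm cutoff}\in[0,\infty]$, and functions $f_{\rm dist}$, $f_{\rm init}$, $f^{(l)}_{\rm aggr,in}$, $f^{(l)}_{\rm update,in}$, $f_{\rm output,in}$, $f^{(l)}_{\rm aggr,out}$, $f^{(l)}_{\rm update,out}$,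 $f_{\rm out}$ with values in arbitrary sets (for instance spaces $\mathbb R^m$). Let $N(i)=\{j: d_{ij}\le r_{\rm cutoff}\}$. The *directed distance* is $$d_{k,ij}=f_{\rm dist}\bigl(\operatorname{sign}((\vec r_{ci}\times\vec r_{cj})\cdot\vec r_{ck}),\,d_{ij}\bigr),\qquad \operatorname{sign}\in\{-1,0,1\}.$$ For each node $k$ and each $i$ with $d_{ki}\le r_{\rm sub}$, the inner network computes $$h_{ki}^{(0)}=f_{\rm init}(x_i,d_{ki},\mathbb 1_{k=i}),\qquad h_{ki}^{(l+1)}=f^{(l)}_{\rm update,in}\Bigl(h_{ki}^{(l)},f^{(l)}_{\rm aggr,in}\bigl(\{\!\!\{(h_{kj}^{(l)},d_{k,ij}) : j\in N(i),\ d_{kj}\le r_{\rm sub}\}\!\!\}\bigr)\Bigr)$$ for $0\le l<N_{\rm in}$. The outer network starts from $h_k^{(0)}=f_{\rm output,in}(\{\!\!\{h_{kj}^{(N_{\rm in})} : d_{kj}\le r_{\rm sub}\}\!\!\})$, computes $$h_i^{(l+1)}=f^{(l)}_{\rm update,out}\bigl(h_i^{(l)},f^{(l)}_{\rm aggr,out}(\{\!\!\{(h_j^{(l)},d_{ij})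 : j\in N(i)\}\!\!\})\bigr)\qquad(0\le l<N_{\rm out}),$$ and the output of the model is $f_{\rm out}(\{\!\!\{h_i^{(N_{\rm out})} : i\in[n]\}\!\!\})$. **Theorem (SE(3)-completeness of GeoNGNN-C).** Consider a GeoNGNN-C in its maximally expressive form, that is, all of its intermediate functions listed above are injective, where distance arguments range over $[0,\infty)$ and multiset arguments over all finite multisets. Suppose that $N_{\rm in}\ge5$, $N_{\rm out}\ge0$, $r_{\rm cutoff}=+\infty$ and $r_{\rm sub}=+\infty$. Then the output of the GeoNGNN-C is SE(3)-complete: it is invariant under proper rigid motions and permutations, and it separates all point clouds that are not related by a proper rigid motion and a permutation, in particular enantiomers (a cloud and its mirror image) whenever these are not SE(3)-isomorphic. -/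

import Mathlib

open scoped NNReal ENNReal Matrix

noncomputable section

/-- A nonempty finite point cloud in three-dimensional Euclidean space, indexed by `Fin n`, whose
points may coincide and carry raw features in `X` (for unlabeled clouds take `X = Unit`). -/
structure PointCloud (X : Type*) where
  n : ℕ
  n_pos : 0 < n
  pt : Fin n → EuclideanSpace ℝ (Fin 3)
  feat : Fin n → X

namespace PointCloud

variable {X : Type*}

/-- Two clouds are related by a proper rigid motion (rotation in SO(3), then translation) and a
permutation of the points (which also matches the raw features). -/
def SE3Iso (P Q : PointCloud X) : Prop :=
  ∃ (e : Fin P.n ≃ Fin Q.n) (R : Matrix (Fin 3) (Fin 3) ℝ) (t : EuclideanSpace ℝ (Fin 3)),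
    R ∈ Matrix.specialOrthogonalGroup (Fin 3) ℝ ∧
      ∀ i, Q.pt (e i) = WithLp.toLp 2 (R *ᵥ (P.pt i).ofLp) + t ∧ Q.feat (e i) = P.feat i

/-- The distance `d_{ij}`. -/
def d (P : PointCloud X) (i j : Fin P.n) : ℝ≥0 := nndist (P.pt i) (P.pt j)

/-- The geometric center `c`. -/
def center (P : PointCloud X) : EuclideanSpace ℝ (Fin 3) := (P.n : ℝ)⁻¹ • ∑ i, P.pt i

/-- The coordinates of the vector `r_{ci}` from the geometric center to the point `i`. -/
def fromCenter (P : PointCloud X) (i : Fin P.n) : Fin 3 → ℝ := (P.pt i - P.center).ofLp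

/-- The orientation sign of `(r_{ci} × r_{cj}) · r_{ck}`. -/
def orient (P : PointCloud X) (k i j : Fin P.n) : SignType :=
  SignType.sign ((P.fromCenter i ⨯₃ P.fromCenter j) ⬝ᵥ P.fromCenter k)

end PointCloud

/-- A GeoNGNN-C: hyperparameters and intermediate functions. Raw features lie in `X`, encoded
directed distances in `D`; `H l`, `A l` are the spaces of node representations and aggregated
messages at inner layer `l`, and `K l`, `B l` those at outer layer `l`; the output lies in `S`. -/
structure GeoNGNNC (X D S : Type*) (H A K B : ℕ → Type*) where
  /-- number of inner layers -/
  nIn : ℕ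
  /-- number of outer layers -/
  nOut : ℕ
  /-- subgraph radius -/
  rSub : ℝ≥0∞
  /-- interaction cutoff -/
  rCutoff : ℝ≥0∞
  fDist : SignType × ℝ≥0 → D
  fInitInner : X × ℝ≥0 × Bool → H 0
  fAggrInner : (l : ℕ) → Multiset (H l × D) → A l
  fUpdateInner : (l : ℕ) → H l × A l → H (l + 1)
  fOutputInner : Multiset (H nIn) → K 0
  fAggrOuter : (l : ℕ) → Multiset (K l × ℝ≥0) → B l
  fUpdateOuter : (l : ℕ) → K l × B l → K (l + 1)
  fOut : Multiset (K nOut) → S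

namespace GeoNGNNC

variable {X D S : Type*} {H A K B : ℕ → Type*}

/-- The directed distance `d_{k,ij}`. -/
def directedDist (M : GeoNGNNC X D S H A K B) (P : PointCloud X) (k i j : Fin P.n) : D :=
  M.fDist (P.orient k i j, P.d i j)

/-- The points of the `rSub`-sized sub-point cloud around `k`. -/
def subcloud (M : GeoNGNNC X D S H A K B) (P : PointCloud X) (k : Fin P.n) : Finset (Fin P.n) :=
  open Classical in Finset.univ.filter fun j => (P.d k j : ℝ≥0∞) ≤ M.rSub

/-- The neighbors of `i` in the distance graph (`i` itself included). -/
def neighbors (M : GeoNGNNC X D S H A K B) (P : PointCloud X) (i : Fin P.n) : Finset (Fin P.n) :=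
  open Classical in Finset.univ.filter fun j => (P.d i j : ℝ≥0∞) ≤ M.rCutoff

/-- `M.innerRep P l k i` is the representation `h_{ki}^{(l)}` of node `i` in the subgraph of node `k`.
Only its values at nodes `i` of that subgraph are ever used. -/
def innerRep (M : GeoNGNNC X D S H A K B) (P : PointCloud X) :
    (l : ℕ) → (k i : Fin P.n) → H l
  | 0 => fun k i => M.fInitInner (P.feat i, P.d k i, decide (k = i))
  | l + 1 => fun k i => M.fUpdateInner l
      (innerRep M P l k i,
        M.fAggrInner l ((M.neighbors P i ∩ M.subcloud P k).val.map fun j =>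
          (innerRep M P l k j, M.directedDist P k i j)))

/-- `M.outerRep P l i` is the representation `h_i^{(l)}` of node `i` in the outer GNN, a message-passing
network on the distance graph with undirected distances. -/
def outerRep (M : GeoNGNNC X D S H A K B) (P : PointCloud X) : (l : ℕ) → (i : Fin P.n) → K l
  | 0 => fun i => M.fOutputInner ((M.subcloud P i).val.map fun j => M.innerRep P M.nIn i j)
  | l + 1 => fun i => M.fUpdateOuter l
      (outerRep M P l i,
        M.fAggrOuter l ((M.neighbors P i).val.map fun j => (outerRep M P l j, P.d i j)))

/-- The representation of the whole cloud. -/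
def output (M : GeoNGNNC X D S H A K B) (P : PointCloud X) : S :=
  M.fOut ((Finset.univ : Finset (Fin P.n)).val.map fun i => M.outerRep P M.nOut i)

/-- The maximally expressive form: all the intermediate functions in use are injective. -/
structure AllInjective (M : GeoNGNNC X D S H A K B) : Prop where
  fDist : Function.Injective M.fDist
  fInitInner : Function.Injective M.fInitInner
  fAggrInner : ∀ l < M.nIn, Function.Injective (M.fAggrInner l)
  fUpdateInner : ∀ l < M.nIn, Function.Injective (M.fUpdateInner l)
  fOutputInner : Function.Injective M.fOutputInner
  fAggrOuter : ∀ l < M.nOut, Function.Injective (M.fAggrOuter l)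
  fUpdateOuter : ∀ l < M.nOut, Function.Injective (M.fUpdateOuter l)
  fOut : Function.Injective M.fOut

end GeoNGNNC

/-- `f` is SE(3)-complete: it is invariant under proper rigid motions and permutations, and it
separates any two clouds (of whatever sizes) that are not related by them. -/
def SE3Complete {X S : Type*} (f : PointCloud X → S) : Prop :=
  (∀ P Q : PointCloud X, P.SE3Iso Q → f P = f Q) ∧
    ∀ P Q : PointCloud X, ¬ P.SE3Iso Q → f P ≠ f Q

end

/-! Invariance holds because distances and signed triple products at the center survive proper rigid
motions. For separation, injectivity lets equal outputs be unwound to equal inner representations.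
One layer fixes the sum of squared distances from a node; a second collects these sums over the
cloud. As the vectors from the center add up to zero, these sums determine every `|r_ci|`, hence all
inner products whose distances are seen. A third layer compares every `j` with a fixed pair `k, i`.
If `r_ck, r_ci` are independent, `r_cj` is fixed by its inner products with them and the triple
product, whose square is a Gram determinant and whose sign is observed
(`exists_rotation_of_gram_eq_of_sign_eq`). If all vectors are parallel, orientation is irrelevant
and one vector suffices (`exists_rotation_of_collinear`). Three inner layers are thus enough. -/

theorem exists_equiv_of_map_univ_eq {ι κ α : Type*} [Fintype ι] [Fintype κ] {f : ι → α} {g : κ → α}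
    (h : (Finset.univ : Finset ι).val.map f = (Finset.univ : Finset κ).val.map g) :
    ∃ e : ι ≃ κ, ∀ i, g (e i) = f i := by
  classical
  -- Equal multiplicities mean fibres of equal size; bijections between fibres are then glued.
  have hcard (a : α) : Fintype.card {i // f i = a} = Fintype.card {j // g j = a} := by
    have := congrArg (Multiset.count a) h
    simp only [Multiset.count_map, eq_comm (a := a)] at this
    rw [Fintype.card_subtype, Fintype.card_subtype]
    exact this
  refine ⟨((Equiv.sigmaFiberEquiv f).symm.trans
    (Equiv.sigmaCongrRight fun a => Fintype.equivOfCardEq (hcard a))).trans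
    (Equiv.sigmaFiberEquiv g), fun i => ?_⟩
  exact (Fintype.equivOfCardEq (hcard (f i)) ⟨i, rfl⟩).2

theorem map_univ_eq_of_equiv {ι κ α : Type*} [Fintype ι] [Fintype κ] {f : ι → α} {g : κ → α}
    (e : ι ≃ κ) (h : ∀ i, g (e i) = f i) :
    (Finset.univ : Finset ι).val.map f = (Finset.univ : Finset κ).val.map g := by
  rw [← Multiset.map_univ_val_equiv e, Multiset.map_map]
  exact Multiset.map_congr rfl fun i _ => (h i).symm

/-! ### Rotations determined by inner products and orientation -/

section Rotation

/-- The right side is the Gram determinant of `u, v, x`, so inner products fix the triple product up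
to sign. -/
theorem cross_dot_sq (u v x : Fin 3 → ℝ) :
    ((u ⨯₃ v) ⬝ᵥ x) ^ 2 =
      (u ⬝ᵥ u) * (v ⬝ᵥ v) * (x ⬝ᵥ x) + 2 * (u ⬝ᵥ v) * (v ⬝ᵥ x) * (u ⬝ᵥ x)
        - (u ⬝ᵥ u) * (v ⬝ᵥ x) ^ 2 - (v ⬝ᵥ v) * (u ⬝ᵥ x) ^ 2 - (x ⬝ᵥ x) * (u ⬝ᵥ v) ^ 2 := by
  simp only [cross_apply, dotProduct, Fin.sum_univ_three, Matrix.cons_val]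
  ring

theorem cross_dot_cross_self (u v : Fin 3 → ℝ) :
    (u ⨯₃ v) ⬝ᵥ (u ⨯₃ v) = (u ⬝ᵥ u) * (v ⬝ᵥ v) - (u ⬝ᵥ v) ^ 2 := by
  rw [cross_dot_cross, dotProduct_comm v u]; ring

theorem eq_of_sq_eq_of_sign_eq {a b : ℝ} (h : a ^ 2 = b ^ 2)
    (hs : SignType.sign a = SignType.sign b) : a = b := by
  rcases sq_eq_sq_iff_eq_or_eq_neg.1 h with h | rfl
  · exact h
  · rw [Left.sign_neg] at hs
    have : SignType.sign b = 0 := by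
      revert hs; generalize SignType.sign b = s; revert s; decide
    simp [sign_eq_zero_iff.1 this]

/-- Two pairs of linearly independent vectors with the same Gram matrix are related by a rotation,
which maps any vector to the one with the same coordinates relative to the pair and its cross
product. -/
theorem exists_rotation_of_gram_eq {u v u' v' : Fin 3 → ℝ} (h0 : u ⨯₃ v ≠ 0)
    (huu : u ⬝ᵥ u = u' ⬝ᵥ u') (hvv : v ⬝ᵥ v = v' ⬝ᵥ v') (huv : u ⬝ᵥ v = u' ⬝ᵥ v') :
    ∃ R ∈ Matrix.specialOrthogonalGroup (Fin 3) ℝ, ∀ x y,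
      u ⬝ᵥ x = u' ⬝ᵥ y → v ⬝ᵥ x = v' ⬝ᵥ y → (u ⨯₃ v) ⬝ᵥ x = (u' ⨯₃ v') ⬝ᵥ y → R *ᵥ x = y := by
  have hcc : (u ⨯₃ v) ⬝ᵥ (u ⨯₃ v) = (u' ⨯₃ v') ⬝ᵥ (u' ⨯₃ v') := by
    rw [cross_dot_cross_self, cross_dot_cross_self, huu, hvv, huv]
  have hdet (a b : Fin 3 → ℝ) :
      Matrix.det (Matrix.of ![a, b, a ⨯₃ b]) = (a ⨯₃ b) ⬝ᵥ (a ⨯₃ b) := by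
    rw [← triple_product_permutation, ← triple_product_permutation, triple_product_eq_det]
    rfl
  have hpos : (u' ⨯₃ v') ⬝ᵥ (u' ⨯₃ v') ≠ 0 := by
    rwa [← hcc, Ne, dotProduct_self_eq_zero]
  set A : Matrix (Fin 3) (Fin 3) ℝ := Matrix.of ![u, v, u ⨯₃ v] with hA
  set B : Matrix (Fin 3) (Fin 3) ℝ := Matrix.of ![u', v', u' ⨯₃ v'] with hB
  have hBu : IsUnit B.det := by rw [hB, hdet]; exact hpos.isUnit
  have hgram : A * Aᵀ = B * Bᵀ := by
    ext i j
    have key (a : Fin 3 → Fin 3 → ℝ) : (Matrix.of a * (Matrix.of a)ᵀ) i j = a i ⬝ᵥ a j := rfl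
    rw [hA, hB, key, key]
    have e1 (a b : Fin 3 → ℝ) : (a ⨯₃ b) ⬝ᵥ a = 0 := by rw [dotProduct_comm, dot_self_cross]
    have e2 (a b : Fin 3 → ℝ) : (a ⨯₃ b) ⬝ᵥ b = 0 := by rw [dotProduct_comm, dot_cross_self]
    fin_cases i <;> fin_cases j <;>
      simp [huu, hvv, huv, hcc, e1, e2, dotProduct_comm v u, dotProduct_comm v' u']
  -- Equal Gram matrices make `B⁻¹ * A` orthogonal. Both determinants equal the same squared norm of
  -- a cross product, so its determinant is 1, not -1.
  refine ⟨B⁻¹ * A, ?_, fun x y h1 h2 h3 => ?_⟩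
  · rw [Matrix.mem_specialOrthogonalGroup_iff, Matrix.mem_orthogonalGroup_iff]
    constructor
    · have : (B⁻¹ * A)ᵀ = Aᵀ * Bᵀ⁻¹ := by
        rw [Matrix.transpose_mul, Matrix.transpose_nonsing_inv]
      rw [this, Matrix.mul_assoc, ← Matrix.mul_assoc A, hgram, Matrix.mul_assoc B,
        Matrix.mul_nonsing_inv _ (by rwa [Matrix.det_transpose]), Matrix.mul_one,
        Matrix.nonsing_inv_mul _ hBu]
    · rw [Matrix.det_mul, Matrix.det_nonsing_inv, hA, hB, hdet, hdet, hcc]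
      exact Ring.inverse_mul_cancel _ hpos.isUnit
  · have : A *ᵥ x = B *ᵥ y := by
      ext i
      fin_cases i
      · exact h1
      · exact h2
      · exact h3
    rw [← Matrix.mulVec_mulVec, this, Matrix.mulVec_mulVec, Matrix.nonsing_inv_mul _ hBu,
      Matrix.one_mulVec]

theorem exists_unit_dotProduct_eq_zero (w : Fin 3 → ℝ) :
    ∃ u : Fin 3 → ℝ, u ⬝ᵥ u = 1 ∧ w ⬝ᵥ u = 0 := by
  have key (u : Fin 3 → ℝ) (hu : u ≠ 0) (h : w ⬝ᵥ u = 0) :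
      ∃ u : Fin 3 → ℝ, u ⬝ᵥ u = 1 ∧ w ⬝ᵥ u = 0 := by
    have hp : 0 < u ⬝ᵥ u :=
      lt_of_le_of_ne (by simpa using dotProduct_star_self_nonneg u)
        (Ne.symm (by rwa [Ne, dotProduct_self_eq_zero]))
    refine ⟨(√(u ⬝ᵥ u))⁻¹ • u, ?_, by simp [h]⟩
    rw [smul_dotProduct, dotProduct_smul, smul_eq_mul, smul_eq_mul, ← mul_assoc, ← mul_inv,
      Real.mul_self_sqrt hp.le, inv_mul_cancel₀ hp.ne']
  by_cases h : w 0 = 0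
  · exact key ![1, 0, 0] (fun h => by simpa using congrFun h 0)
      (by simp [dotProduct, Fin.sum_univ_three, h])
  · exact key ![-w 1, w 0, 0] (fun h' => h (by simpa using congrFun h' 1))
      (by simp [dotProduct, Fin.sum_univ_three]; ring)

theorem exists_rotation_mulVec_eq {v w : Fin 3 → ℝ} (hvw : v ⬝ᵥ v = w ⬝ᵥ w) :
    ∃ R ∈ Matrix.specialOrthogonalGroup (Fin 3) ℝ, R *ᵥ v = w := by
  by_cases hv : v = 0
  · subst hv
    refine ⟨1, one_mem _, ?_⟩
    rw [dotProduct_zero, eq_comm, dotProduct_self_eq_zero] at hvw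
    simp [hvw]
  -- A unit normal completes each single vector to a pair, and the two pairs have the same Gram
  -- matrix.
  obtain ⟨a, ha1, ha2⟩ := exists_unit_dotProduct_eq_zero v
  obtain ⟨b, hb1, hb2⟩ := exists_unit_dotProduct_eq_zero w
  have h0 : v ⨯₃ a ≠ 0 := by
    rw [Ne, ← dotProduct_self_eq_zero, cross_dot_cross_self, ha1, ha2]
    simpa using hv
  obtain ⟨R, hR, h⟩ := exists_rotation_of_gram_eq h0 hvw (ha1.trans hb1.symm) (ha2.trans hb2.symm)
  refine ⟨R, hR, h v w hvw ?_ ?_⟩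
  · rw [dotProduct_comm, ha2, dotProduct_comm, hb2]
  · rw [dotProduct_comm, dot_self_cross, dotProduct_comm, dot_self_cross]

/-- The sign resolves the ambiguity left by the Gram determinant; without it, mirror images could
not be told apart. -/
theorem exists_rotation_of_gram_eq_of_sign_eq {ι : Type*} {u v u' v' : Fin 3 → ℝ} {x y : ι → Fin 3 → ℝ}
    (h0 : u ⨯₃ v ≠ 0) (huu : u ⬝ᵥ u = u' ⬝ᵥ u') (hvv : v ⬝ᵥ v = v' ⬝ᵥ v')
    (huv : u ⬝ᵥ v = u' ⬝ᵥ v') (hxx : ∀ i, x i ⬝ᵥ x i = y i ⬝ᵥ y i)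
    (hux : ∀ i, u ⬝ᵥ x i = u' ⬝ᵥ y i) (hvx : ∀ i, v ⬝ᵥ x i = v' ⬝ᵥ y i)
    (hs : ∀ i, SignType.sign ((u ⨯₃ v) ⬝ᵥ x i) = SignType.sign ((u' ⨯₃ v') ⬝ᵥ y i)) :
    ∃ R ∈ Matrix.specialOrthogonalGroup (Fin 3) ℝ, ∀ i, R *ᵥ x i = y i := by
  obtain ⟨R, hR, h⟩ := exists_rotation_of_gram_eq h0 huu hvv huv
  refine ⟨R, hR, fun i => h _ _ (hux i) (hvx i) (eq_of_sq_eq_of_sign_eq ?_ (hs i))⟩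
  rw [cross_dot_sq, cross_dot_sq, huu, hvv, huv, hxx, hux, hvx]

theorem exists_rotation_of_collinear {ι : Type*} {v w : Fin 3 → ℝ} {x y : ι → Fin 3 → ℝ}
    (hv : v ≠ 0) (hvw : v ⬝ᵥ v = w ⬝ᵥ w) (hx : ∀ i, v ⨯₃ x i = 0)
    (hxx : ∀ i, x i ⬝ᵥ x i = y i ⬝ᵥ y i) (hvx : ∀ i, v ⬝ᵥ x i = w ⬝ᵥ y i) :
    ∃ R ∈ Matrix.specialOrthogonalGroup (Fin 3) ℝ, ∀ i, R *ᵥ x i = y i := by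
  have hpos : v ⬝ᵥ v ≠ 0 := by rwa [Ne, dotProduct_self_eq_zero]
  have key {v x : Fin 3 → ℝ} (hpos : v ⬝ᵥ v ≠ 0) (h : v ⨯₃ x = 0) :
      x = ((v ⬝ᵥ x) / (v ⬝ᵥ v)) • v := by
    have := cross_cross_eq_smul_sub_smul' v v x
    rw [h, map_zero] at this
    rw [div_eq_inv_mul, mul_smul, sub_eq_zero.1 this.symm, smul_smul, inv_mul_cancel₀ hpos,
      one_smul]
  obtain ⟨R, hR, h⟩ := exists_rotation_mulVec_eq hvw
  refine ⟨R, hR, fun i => ?_⟩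
  -- Lagrange's identity expresses `|w × y|²` through inner products, so collinearity passes from
  -- `x` to `y`.
  have hy : w ⨯₃ y i = 0 := by
    rw [← dotProduct_self_eq_zero, cross_dot_cross_self, ← hvw, ← hxx, ← hvx,
      ← cross_dot_cross_self, hx, dotProduct_zero]
  rw [key hpos (hx i), key (hvw ▸ hpos) hy, Matrix.mulVec_smul, h, hvw, hvx]

theorem cross_mulVec_dot_mulVec {R : Matrix (Fin 3) (Fin 3) ℝ}
    (hR : R ∈ Matrix.specialOrthogonalGroup (Fin 3) ℝ) (u v w : Fin 3 → ℝ) :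
    ((R *ᵥ u) ⨯₃ (R *ᵥ v)) ⬝ᵥ (R *ᵥ w) = (u ⨯₃ v) ⬝ᵥ w := by
  have hdet := (Matrix.mem_specialOrthogonalGroup_iff.1 hR).2
  have key (a b c : Fin 3 → ℝ) : (a ⨯₃ b) ⬝ᵥ c = (Matrix.of ![c, a, b]).det := by
    rw [dotProduct_comm, triple_product_eq_det]; rfl
  have : Matrix.of ![R *ᵥ w, R *ᵥ u, R *ᵥ v] = Matrix.of ![w, u, v] * Rᵀ := by
    ext i j
    fin_cases i <;> simp [Matrix.mul_apply, Matrix.mulVec, dotProduct, mul_comm]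
  rw [key, key, this, Matrix.det_mul, Matrix.det_transpose, hdet, mul_one]

theorem mulVec_dotProduct_mulVec {R : Matrix (Fin 3) (Fin 3) ℝ}
    (hR : R ∈ Matrix.specialOrthogonalGroup (Fin 3) ℝ) (u v : Fin 3 → ℝ) :
    (R *ᵥ u) ⬝ᵥ (R *ᵥ v) = u ⬝ᵥ v := by
  have h := (Matrix.mem_orthogonalGroup_iff' _ _).1 (Matrix.mem_specialOrthogonalGroup_iff.1 hR).1
  rw [Matrix.dotProduct_mulVec, Matrix.vecMul_mulVec, ← Matrix.dotProduct_mulVec, h,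
    Matrix.one_mulVec]

end Rotation

/-! ### Geometry relative to the center -/

namespace PointCloud

variable {X : Type*}

theorem sum_fromCenter (P : PointCloud X) : ∑ i, P.fromCenter i = 0 := by
  have hn : (P.n : ℝ) ≠ 0 := by exact_mod_cast P.n_pos.ne'
  have h : ∑ i, (P.pt i - P.center) = 0 := by
    rw [Finset.sum_sub_distrib, Finset.sum_const, Finset.card_univ, Fintype.card_fin,
      ← Nat.cast_smul_eq_nsmul ℝ, center, smul_smul, mul_inv_cancel₀ hn, one_smul, sub_self]
  have := congrArg (WithLp.linearEquiv 2 ℝ (Fin 3 → ℝ)) h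
  rwa [map_sum, map_zero] at this

theorem d_sq (P : PointCloud X) (i j : Fin P.n) :
    (P.d i j : ℝ) ^ 2 = P.fromCenter i ⬝ᵥ P.fromCenter i + P.fromCenter j ⬝ᵥ P.fromCenter j
      - 2 * (P.fromCenter i ⬝ᵥ P.fromCenter j) := by
  rw [d, coe_nndist, EuclideanSpace.dist_sq_eq]
  simp only [Real.dist_eq, sq_abs, fromCenter, dotProduct, Fin.sum_univ_three, WithLp.ofLp_sub,
    Pi.sub_apply]
  ring

/-- The cross terms vanish because the vectors from the center sum to zero. -/
theorem sum_d_sq (P : PointCloud X) (i : Fin P.n) :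
    ∑ j, (P.d i j : ℝ) ^ 2 = P.n * (P.fromCenter i ⬝ᵥ P.fromCenter i)
      + ∑ j, P.fromCenter j ⬝ᵥ P.fromCenter j := by
  have h : ∑ j, P.fromCenter i ⬝ᵥ P.fromCenter j = 0 := by
    rw [← dotProduct_sum, sum_fromCenter, dotProduct_zero]
  simp only [d_sq, Finset.sum_sub_distrib, Finset.sum_add_distrib, ← Finset.mul_sum, h]
  simp

theorem sum_sum_d_sq (P : PointCloud X) :
    ∑ i, ∑ j, (P.d i j : ℝ) ^ 2 = 2 * P.n * ∑ j, P.fromCenter j ⬝ᵥ P.fromCenter j := by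
  simp only [sum_d_sq, Finset.sum_add_distrib, ← Finset.mul_sum]
  simp
  ring

/-- The distance of a point to the center is determined by sums of squared distances. -/
theorem fromCenter_dot_self_eq {P Q : PointCloud X} (hn : P.n = Q.n)
    (hS : ∑ i, ∑ j, (P.d i j : ℝ) ^ 2 = ∑ i, ∑ j, (Q.d i j : ℝ) ^ 2)
    {i : Fin P.n} {i' : Fin Q.n} (hi : ∑ j, (P.d i j : ℝ) ^ 2 = ∑ j, (Q.d i' j : ℝ) ^ 2) :
    P.fromCenter i ⬝ᵥ P.fromCenter i = Q.fromCenter i' ⬝ᵥ Q.fromCenter i' := by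
  have h0 : (Q.n : ℝ) ≠ 0 := by exact_mod_cast Q.n_pos.ne'
  have hn' : (P.n : ℝ) = Q.n := congrArg _ hn
  rw [sum_sum_d_sq, sum_sum_d_sq, hn'] at hS
  have hS' := mul_left_cancel₀ (mul_ne_zero two_ne_zero h0) hS
  rw [sum_d_sq, sum_d_sq, hS', hn'] at hi
  exact mul_left_cancel₀ h0 (add_right_cancel hi)

theorem fromCenter_dot_eq {P Q : PointCloud X} {i j : Fin P.n} {i' j' : Fin Q.n}
    (hi : P.fromCenter i ⬝ᵥ P.fromCenter i = Q.fromCenter i' ⬝ᵥ Q.fromCenter i')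
    (hj : P.fromCenter j ⬝ᵥ P.fromCenter j = Q.fromCenter j' ⬝ᵥ Q.fromCenter j')
    (hd : Q.d i' j' = P.d i j) :
    P.fromCenter i ⬝ᵥ P.fromCenter j = Q.fromCenter i' ⬝ᵥ Q.fromCenter j' := by
  have h1 := P.d_sq i j
  have h2 := Q.d_sq i' j'
  rw [hd] at h2
  linarith

/-- A cyclic shift makes `k, i` the reference frame and `j` the vector to be located. -/
theorem orient_eq_sign (P : PointCloud X) (k i j : Fin P.n) :
    P.orient k i j = SignType.sign ((P.fromCenter k ⨯₃ P.fromCenter i) ⬝ᵥ P.fromCenter j) := by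
  rw [orient, dotProduct_comm, triple_product_permutation, triple_product_permutation,
    dotProduct_comm]

theorem se3Iso_of_fromCenter {P Q : PointCloud X} (e : Fin P.n ≃ Fin Q.n)
    {R : Matrix (Fin 3) (Fin 3) ℝ} (hR : R ∈ Matrix.specialOrthogonalGroup (Fin 3) ℝ)
    (h : ∀ i, R *ᵥ P.fromCenter i = Q.fromCenter (e i)) (hf : ∀ i, Q.feat (e i) = P.feat i) :
    P.SE3Iso Q := by
  refine ⟨e, R, Q.center - WithLp.toLp 2 (R *ᵥ P.center.ofLp), hR, fun i => ⟨?_, hf i⟩⟩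
  have := congrArg (WithLp.toLp 2) (h i)
  simp only [fromCenter, WithLp.ofLp_sub, Matrix.mulVec_sub, WithLp.toLp_sub,
    WithLp.toLp_ofLp] at this
  rw [add_sub_left_comm, this, add_sub_cancel]

theorem SE3Iso.exists_fromCenter {P Q : PointCloud X} (h : P.SE3Iso Q) :
    ∃ e : Fin P.n ≃ Fin Q.n, ∃ R ∈ Matrix.specialOrthogonalGroup (Fin 3) ℝ,
      (∀ i, Q.fromCenter (e i) = R *ᵥ P.fromCenter i) ∧ ∀ i, Q.feat (e i) = P.feat i := by
  obtain ⟨e, R, t, hR, h⟩ := h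
  refine ⟨e, R, hR, fun i => ?_, fun i => (h i).2⟩
  have hn : (P.n : ℝ) = Q.n := congrArg _ (by simpa using Fintype.card_congr e)
  have hc : Q.center = WithLp.toLp 2 (R *ᵥ P.center.ofLp) + t := by
    have h0 : (Q.n : ℝ) ≠ 0 := by exact_mod_cast Q.n_pos.ne'
    rw [center, center, ← e.sum_comp, Finset.sum_congr rfl fun i _ => (h i).1,
      Finset.sum_add_distrib, Finset.sum_const, Finset.card_univ, Fintype.card_fin,
      ← Nat.cast_smul_eq_nsmul ℝ, hn, smul_add, smul_smul, inv_mul_cancel₀ h0, one_smul,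
      WithLp.ofLp_smul, Matrix.mulVec_smul, WithLp.toLp_smul, WithLp.ofLp_sum, Matrix.mulVec_sum,
      WithLp.toLp_sum]
  rw [fromCenter, fromCenter, (h i).1, hc, add_sub_add_right_eq_sub, WithLp.ofLp_sub,
    WithLp.ofLp_sub, Matrix.mulVec_sub]

end PointCloud

namespace GeoNGNNC

variable {X D S : Type*} {H A K B : ℕ → Type*} {M : GeoNGNNC X D S H A K B}

theorem neighbors_eq_univ (h : M.rCutoff = ⊤) (P : PointCloud X) (i : Fin P.n) :
    M.neighbors P i = Finset.univ := by
  simp [neighbors, h]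

theorem subcloud_eq_univ (h : M.rSub = ⊤) (P : PointCloud X) (i : Fin P.n) :
    M.subcloud P i = Finset.univ := by
  simp [subcloud, h]

theorem innerRep_succ (hC : M.rCutoff = ⊤) (hS : M.rSub = ⊤) (P : PointCloud X) (l : ℕ)
    (k i : Fin P.n) : M.innerRep P (l + 1) k i = M.fUpdateInner l (M.innerRep P l k i,
      M.fAggrInner l ((Finset.univ : Finset (Fin P.n)).val.map fun j =>
        (M.innerRep P l k j, M.directedDist P k i j))) := by
  simp only [innerRep, neighbors_eq_univ hC, subcloud_eq_univ hS, Finset.univ_inter]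

theorem outerRep_zero (hS : M.rSub = ⊤) (P : PointCloud X) (i : Fin P.n) :
    M.outerRep P 0 i = M.fOutputInner ((Finset.univ : Finset (Fin P.n)).val.map fun j =>
      M.innerRep P M.nIn i j) := by
  simp only [outerRep, subcloud_eq_univ hS]

theorem outerRep_succ (hC : M.rCutoff = ⊤) (P : PointCloud X) (l : ℕ) (i : Fin P.n) :
    M.outerRep P (l + 1) i = M.fUpdateOuter l (M.outerRep P l i,
      M.fAggrOuter l ((Finset.univ : Finset (Fin P.n)).val.map fun j =>
        (M.outerRep P l j, P.d i j))) := by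
  simp only [outerRep, neighbors_eq_univ hC]

/-! ### Invariance under proper rigid motions -/

section Invariance

variable {P Q : PointCloud X} {e : Fin P.n ≃ Fin Q.n}

theorem innerRep_equiv (hC : M.rCutoff = ⊤) (hS : M.rSub = ⊤)
    (hf : ∀ i, Q.feat (e i) = P.feat i) (hd : ∀ i j, Q.d (e i) (e j) = P.d i j)
    (ho : ∀ k i j, Q.orient (e k) (e i) (e j) = P.orient k i j) (l : ℕ) (k i : Fin P.n) :
    M.innerRep Q l (e k) (e i) = M.innerRep P l k i := by
  induction l generalizing k i with
  | zero => simp only [innerRep, hf, hd, e.injective.eq_iff]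
  | succ l ih =>
    rw [innerRep_succ hC hS, innerRep_succ hC hS, ih, map_univ_eq_of_equiv e fun j => ?_]
    simp only [ih, directedDist, hd, ho]

theorem outerRep_equiv (hC : M.rCutoff = ⊤) (hS : M.rSub = ⊤)
    (hf : ∀ i, Q.feat (e i) = P.feat i) (hd : ∀ i j, Q.d (e i) (e j) = P.d i j)
    (ho : ∀ k i j, Q.orient (e k) (e i) (e j) = P.orient k i j) (l : ℕ) (i : Fin P.n) :
    M.outerRep Q l (e i) = M.outerRep P l i := by
  induction l generalizing i with
  | zero =>
    rw [outerRep_zero hS, outerRep_zero hS,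
      map_univ_eq_of_equiv e fun j => innerRep_equiv hC hS hf hd ho M.nIn i j]
  | succ l ih =>
    rw [outerRep_succ hC, outerRep_succ hC, ih, map_univ_eq_of_equiv e fun j => ?_]
    simp only [ih, hd]

theorem output_eq_of_se3Iso (hC : M.rCutoff = ⊤) (hS : M.rSub = ⊤) (h : P.SE3Iso Q) :
    M.output P = M.output Q := by
  obtain ⟨e, R, hR, hv, hf⟩ := h.exists_fromCenter
  have hd (i j) : Q.d (e i) (e j) = P.d i j := by
    have : (Q.d (e i) (e j) : ℝ) ^ 2 = (P.d i j : ℝ) ^ 2 := by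
      simp only [PointCloud.d_sq, hv, mulVec_dotProduct_mulVec hR]
    exact NNReal.coe_injective ((sq_eq_sq₀ (NNReal.coe_nonneg _) (NNReal.coe_nonneg _)).1 this)
  have ho (k i j) : Q.orient (e k) (e i) (e j) = P.orient k i j := by
    simp only [PointCloud.orient, hv, cross_mulVec_dot_mulVec hR]
  rw [output, output, map_univ_eq_of_equiv e fun j => outerRep_equiv hC hS hf hd ho M.nOut j]

end Invariance

/-! ### Recovering the cloud from the output -/

section Separation

variable {P Q : PointCloud X}

theorem AllInjective.innerRep_succ_eq (hM : M.AllInjective) (hC : M.rCutoff = ⊤) (hS : M.rSub = ⊤)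
    {l : ℕ} (hl : l < M.nIn) {k i : Fin P.n} {k' i' : Fin Q.n}
    (h : M.innerRep P (l + 1) k i = M.innerRep Q (l + 1) k' i') :
    M.innerRep P l k i = M.innerRep Q l k' i' ∧ ∃ e : Fin P.n ≃ Fin Q.n, ∀ j,
      M.innerRep P l k j = M.innerRep Q l k' (e j) ∧ P.orient k i j = Q.orient k' i' (e j) ∧
        Q.d i' (e j) = P.d i j := by
  rw [innerRep_succ hC hS, innerRep_succ hC hS] at h
  have h1 := Prod.mk.inj (hM.fUpdateInner l hl h)
  obtain ⟨e, he⟩ := exists_equiv_of_map_univ_eq (hM.fAggrInner l hl h1.2)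
  refine ⟨h1.1, e, fun j => ?_⟩
  have h2 := Prod.mk.inj (he j)
  have h3 := Prod.mk.inj (hM.fDist h2.2)
  exact ⟨h2.1.symm, h3.1.symm, h3.2⟩

theorem AllInjective.innerRep_eq_of_le (hM : M.AllInjective) (hC : M.rCutoff = ⊤)
    (hS : M.rSub = ⊤) {l m : ℕ} (hlm : l ≤ m) (hm : m ≤ M.nIn) {k i : Fin P.n} {k' i' : Fin Q.n}
    (h : M.innerRep P m k i = M.innerRep Q m k' i') :
    M.innerRep P l k i = M.innerRep Q l k' i' := by
  induction m, hlm using Nat.le_induction with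
  | base => exact h
  | succ m _ ih => exact ih (by omega) (hM.innerRep_succ_eq hC hS (by omega) h).1

theorem AllInjective.innerRep_zero_eq (hM : M.AllInjective) {k i : Fin P.n} {k' i' : Fin Q.n}
    (h : M.innerRep P 0 k i = M.innerRep Q 0 k' i') :
    P.feat i = Q.feat i' ∧ Q.d k' i' = P.d k i ∧ (k = i ↔ k' = i') := by
  have h1 := Prod.mk.inj (hM.fInitInner h)
  have h2 := Prod.mk.inj h1.2
  exact ⟨h1.1, h2.1.symm, decide_eq_decide.1 h2.2⟩

theorem AllInjective.sum_d_sq_eq (hM : M.AllInjective) (hC : M.rCutoff = ⊤) (hS : M.rSub = ⊤)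
    (hl : 0 < M.nIn) {k i : Fin P.n} {k' i' : Fin Q.n}
    (h : M.innerRep P 1 k i = M.innerRep Q 1 k' i') :
    ∑ j, (P.d i j : ℝ) ^ 2 = ∑ j, (Q.d i' j : ℝ) ^ 2 := by
  obtain ⟨-, e, he⟩ := hM.innerRep_succ_eq hC hS hl h
  exact Fintype.sum_equiv e _ _ fun j => by rw [(he j).2.2]

/-- Two inner layers determine a node's position relative to the center and the marked node. -/
theorem AllInjective.dot_eq_of_innerRep_two (hM : M.AllInjective) (hC : M.rCutoff = ⊤)
    (hS : M.rSub = ⊤) (hl : 1 < M.nIn) {k i : Fin P.n} {k' i' : Fin Q.n}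
    (h : M.innerRep P 2 k i = M.innerRep Q 2 k' i') :
    P.fromCenter i ⬝ᵥ P.fromCenter i = Q.fromCenter i' ⬝ᵥ Q.fromCenter i' ∧
      P.fromCenter k ⬝ᵥ P.fromCenter k = Q.fromCenter k' ⬝ᵥ Q.fromCenter k' ∧
      P.fromCenter k ⬝ᵥ P.fromCenter i = Q.fromCenter k' ⬝ᵥ Q.fromCenter i' := by
  obtain ⟨h1, e, he⟩ := hM.innerRep_succ_eq hC hS hl h
  have hl0 : 0 < M.nIn := by omega
  have hn : P.n = Q.n := by simpa using Fintype.card_congr e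
  have hsum (j) := hM.sum_d_sq_eq hC hS hl0 (he j).1
  have hS2 : ∑ i, ∑ j, (P.d i j : ℝ) ^ 2 = ∑ i, ∑ j, (Q.d i j : ℝ) ^ 2 :=
    Fintype.sum_equiv e _ _ hsum
  have hi := PointCloud.fromCenter_dot_self_eq hn hS2 (hM.sum_d_sq_eq hC hS hl0 h1)
  -- The indicator in the initial features forces the matching to send marked node to marked node.
  have hk : k' = e k :=
    (hM.innerRep_zero_eq (hM.innerRep_succ_eq hC hS hl0 (he k).1).1).2.2.1 rfl
  have hkk := PointCloud.fromCenter_dot_self_eq hn hS2 (hsum k)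
  rw [← hk] at hkk
  exact ⟨hi, hkk, PointCloud.fromCenter_dot_eq hkk hi
    (hM.innerRep_zero_eq (hM.innerRep_succ_eq hC hS hl0 h1).1).2.1⟩

/-- Three inner layers determine the cloud relative to the center, the marked node and the node. -/
theorem AllInjective.exists_equiv_of_innerRep_three (hM : M.AllInjective) (hC : M.rCutoff = ⊤)
    (hS : M.rSub = ⊤) (hl : 2 < M.nIn) {k i : Fin P.n} {k' i' : Fin Q.n}
    (h : M.innerRep P 3 k i = M.innerRep Q 3 k' i') :
    ∃ e : Fin P.n ≃ Fin Q.n, ∀ j, Q.feat (e j) = P.feat j ∧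
      P.fromCenter j ⬝ᵥ P.fromCenter j = Q.fromCenter (e j) ⬝ᵥ Q.fromCenter (e j) ∧
      P.fromCenter k ⬝ᵥ P.fromCenter j = Q.fromCenter k' ⬝ᵥ Q.fromCenter (e j) ∧
      P.fromCenter i ⬝ᵥ P.fromCenter j = Q.fromCenter i' ⬝ᵥ Q.fromCenter (e j) ∧
      P.orient k i j = Q.orient k' i' (e j) := by
  obtain ⟨h2, e, he⟩ := hM.innerRep_succ_eq hC hS hl h
  have hi := (hM.dot_eq_of_innerRep_two hC hS (by omega) h2).1
  refine ⟨e, fun j => ?_⟩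
  obtain ⟨hj, ho, hd⟩ := he j
  obtain ⟨hjj, -, hkj⟩ := hM.dot_eq_of_innerRep_two hC hS (by omega) hj
  exact ⟨(hM.innerRep_zero_eq (hM.innerRep_eq_of_le hC hS (Nat.zero_le 2) hl.le hj)).1.symm,
    hjj, hkj, PointCloud.fromCenter_dot_eq hi hjj hd, ho⟩

theorem AllInjective.outerRep_zero_eq (hM : M.AllInjective) (hC : M.rCutoff = ⊤) {l : ℕ}
    (hl : l ≤ M.nOut) {i : Fin P.n} {i' : Fin Q.n} (h : M.outerRep P l i = M.outerRep Q l i') :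
    M.outerRep P 0 i = M.outerRep Q 0 i' := by
  induction l with
  | zero => exact h
  | succ l ih =>
    rw [outerRep_succ hC, outerRep_succ hC] at h
    exact ih (by omega) (Prod.mk.inj (hM.fUpdateOuter l (by omega) h)).1

theorem AllInjective.exists_innerRep_eq (hM : M.AllInjective) (hC : M.rCutoff = ⊤)
    (hS : M.rSub = ⊤) (h : M.output P = M.output Q) (k : Fin P.n) :
    ∃ k' : Fin Q.n, ∀ i, ∃ i', M.innerRep P M.nIn k i = M.innerRep Q M.nIn k' i' := by
  obtain ⟨e, he⟩ := exists_equiv_of_map_univ_eq (hM.fOut h)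
  have h0 := hM.outerRep_zero_eq hC le_rfl (he k).symm
  rw [outerRep_zero hS, outerRep_zero hS] at h0
  obtain ⟨e', he'⟩ := exists_equiv_of_map_univ_eq (hM.fOutputInner h0)
  exact ⟨e k, fun i => ⟨e' i, (he' i).symm⟩⟩

theorem AllInjective.se3Iso_of_output_eq (hM : M.AllInjective) (hC : M.rCutoff = ⊤)
    (hS : M.rSub = ⊤) (hl : 2 < M.nIn) (h : M.output P = M.output Q) : P.SE3Iso Q := by
  have hrep (k : Fin P.n) :
      ∃ k' : Fin Q.n, ∀ i, ∃ i', M.innerRep P 3 k i = M.innerRep Q 3 k' i' := by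
    obtain ⟨k', hk'⟩ := hM.exists_innerRep_eq hC hS h k
    refine ⟨k', fun i => ?_⟩
    obtain ⟨i', hi'⟩ := hk' i
    exact ⟨i', hM.innerRep_eq_of_le hC hS hl le_rfl hi'⟩
  have hdot {k i : Fin P.n} {k' i' : Fin Q.n}
      (h3 : M.innerRep P 3 k i = M.innerRep Q 3 k' i') :=
    hM.dot_eq_of_innerRep_two hC hS (by omega) (hM.innerRep_eq_of_le hC hS (Nat.le_succ 2) hl h3)
  -- Three cases, by whether the vectors from the center span at least a plane, a line, or only
  -- zero.
  by_cases hA : ∃ k i, P.fromCenter k ⨯₃ P.fromCenter i ≠ 0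
  · obtain ⟨k, i, h0⟩ := hA
    obtain ⟨k', hk'⟩ := hrep k
    obtain ⟨i', h3⟩ := hk' i
    obtain ⟨e, he⟩ := hM.exists_equiv_of_innerRep_three hC hS hl h3
    obtain ⟨hii, hkk, hki⟩ := hdot h3
    obtain ⟨R, hR, hRv⟩ := exists_rotation_of_gram_eq_of_sign_eq h0 hkk hii hki
      (fun j => (he j).2.1) (fun j => (he j).2.2.1) (fun j => (he j).2.2.2.1)
      (fun j => by rw [← P.orient_eq_sign, ← Q.orient_eq_sign, (he j).2.2.2.2])
    exact PointCloud.se3Iso_of_fromCenter e hR hRv fun j => (he j).1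
  push Not at hA
  by_cases hB : ∃ k, P.fromCenter k ≠ 0
  · obtain ⟨k, h0⟩ := hB
    obtain ⟨k', hk'⟩ := hrep k
    -- The second node may be `k` itself, as only inner products with `r_ck` are needed on a line.
    obtain ⟨i', h3⟩ := hk' k
    obtain ⟨e, he⟩ := hM.exists_equiv_of_innerRep_three hC hS hl h3
    obtain ⟨R, hR, hRv⟩ := exists_rotation_of_collinear h0 (hdot h3).2.1 (hA k)
      (fun j => (he j).2.1) (fun j => (he j).2.2.1)
    exact PointCloud.se3Iso_of_fromCenter e hR hRv fun j => (he j).1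
  push Not at hB
  obtain ⟨k', hk'⟩ := hrep ⟨0, P.n_pos⟩
  obtain ⟨i', h3⟩ := hk' ⟨0, P.n_pos⟩
  obtain ⟨e, he⟩ := hM.exists_equiv_of_innerRep_three hC hS hl h3
  refine PointCloud.se3Iso_of_fromCenter e (one_mem _) (fun j => ?_) fun j => (he j).1
  have := (he j).2.1
  rw [hB, dotProduct_zero, eq_comm, dotProduct_self_eq_zero] at this
  rw [hB, this, Matrix.mulVec_zero]

end Separation

end GeoNGNNC

theorem mainTheorem7 {X D S : Type*} {H A K B : ℕ → Type*}
    (M : GeoNGNNC X D S H A K B) (hM : M.AllInjective)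
    (hIn : 5 ≤ M.nIn) (hOut : 0 ≤ M.nOut)
    (hCutoff : M.rCutoff = ⊤) (hSub : M.rSub = ⊤) :
    SE3Complete M.output :=
  ⟨fun _ _ h => GeoNGNNC.output_eq_of_se3Iso hCutoff hSub h,
    fun _ _ h h' => h (hM.se3Iso_of_output_eq hCutoff hSub (by omega) h')⟩
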